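/- Let $K$ be a field, let $n\ge 1$, and let $G$ be a whisker graph on $2n$ vertices: that is, there is a finite simple graph $H$ on $\{x_1,\dots,x_n\}$ such that $V(G)=\{x_1,\dots,x_n,y_1,\dots,y_n\}$ and $E(G)=E(H)\cup\{x_1y_1,\dots,x_ny_n\}$. Let $S=K[x_1,\dots,x_n,y_1,\dots,y_n]$, let $\mathfrak m$ be the ideal generated by all the variables, and let $J(G)\subset S$ be the cover ideal of $G$, generated by the monomials $\prod_{v\in C}v$ with $C$ a minimal vertex cover of $G$. Then: 1. $\operatorname{depth} S/J(G)^k=n-1$ for all sufficiently large $k$, i.e. $\lim_{k\to\infty}\operatorname{depth} S/J(G)^k=n-1$; 2. $\operatorname{dstab}(J(G))\le n$, where $\operatorname{dstab}(J(G))$ is the least integer $k_0\ge 1$ such that $\operatorname{depth} S/J(G)^k=\operatorname{depth} S/J(G)^{k_0}$ for all $k\ge k_0$; 3. $\ell(J(G))=n+1$, where the analytic spread $\ell(J(G))$ is the Krull dimension of the fiber ring $\mathcal R(J(G))/\mathfrak m\mathcal R(J(G))$ and $\mathcal R(J(G))=\bigoplus_{k\ge 0}J(G)^kt^k\subset S[t]$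 is the Rees algebra of $J(G)$. Here $\operatorname{depth} M$, for a nonzero finitely generated graded $S$-module $M$, is the maximal length of an $M$-regular sequence in $\mathfrak m$. -/

import Mathlib

noncomputable section

namespace SimpleGraph

/-- The whisker graph (suspension) of a graph `H`: the vertex `x_v` is `Sum.inl v`, the new vertex
`y_v` is `Sum.inr v`. The edges are those of `H` (between the `x`'s) and the whiskers
`{x_v, y_v}`. -/
def whiskerGraph {V : Type*} (H : SimpleGraph V) : SimpleGraph (V ⊕ V) where
  Adj
    | Sum.inl u, Sum.inl v => H.Adj u v
    | Sum.inl u, Sum.inr v => u = v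
    | Sum.inr u, Sum.inl v => u = v
    | Sum.inr _, Sum.inr _ => False
  symm := ⟨by
    rintro (u | u) (v | v) h
    · exact SimpleGraph.Adj.symm h
    · exact Eq.symm h
    · exact Eq.symm h
    · exact h⟩
  loopless := ⟨by
    rintro (u | u) h
    · exact H.loopless.irrefl u h
    · exact h⟩

/-- `C` is a minimal vertex cover of `G`: a vertex cover no proper subset of which is a vertex
cover. -/
def IsMinimalVertexCover {W : Type*} (G : SimpleGraph W) (C : Finset W) : Prop :=
  Minimal (fun D : Finset W => G.IsVertexCover (D : Set W)) C

/-- The cover ideal of `G` in the polynomial ring over `K` whose variables are the vertices of `G`: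
it is generated by the monomials `∏ v ∈ C, X v`, for `C` a minimal vertex cover of `G`. -/
def coverIdeal {W : Type*} (G : SimpleGraph W) (K : Type*) [Field K] :
    Ideal (MvPolynomial W K) :=
  Ideal.span {u | ∃ C : Finset W, G.IsMinimalVertexCover C ∧ u = ∏ v ∈ C, MvPolynomial.X v}

end SimpleGraph

namespace MvPolynomial

/-- The depth of a nonzero finitely generated graded module `M` over a polynomial ring over a field:
the supremum of the lengths of the `M`-regular sequences contained in the maximal graded ideal
(the ideal generated by the variables). -/
def depth {σ K : Type*} [Field K] (M : Type*) [AddCommGroup M] [Module (MvPolynomial σ K) M] :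
    ℕ∞ :=
  ⨆ (rs : List (MvPolynomial σ K)) (_ : ∀ r ∈ rs, r ∈ idealOfVars σ K)
    (_ : RingTheory.Sequence.IsRegular M rs), (rs.length : ℕ∞)

/-- The depth of `R / I ^ k` as a module over the polynomial ring `R`. -/
def depthQuotPow {σ K : Type*} [Field K] (I : Ideal (MvPolynomial σ K)) (k : ℕ) : ℕ∞ :=
  depth (σ := σ) (K := K) (MvPolynomial σ K ⧸ I ^ k)

/-- `d` is the limit depth of `I`: the depth of `R / I ^ k` equals `d` for all large `k`. -/
def HasLimitDepth {σ K : Type*} [Field K] (I : Ideal (MvPolynomial σ K)) (d : ℕ∞) : Prop :=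
  ∀ᶠ k in Filter.atTop, depthQuotPow I k = d

/-- The depth stability index of `I`: the least integer `k₀ ≥ 1` such that the depth of `R / I ^ k`
equals that of `R / I ^ k₀` for all `k ≥ k₀` (and `⊤` if there is no such `k₀`). -/
def dstab {σ K : Type*} [Field K] (I : Ideal (MvPolynomial σ K)) : ℕ∞ :=
  ⨅ (k₀ : ℕ) (_ : 1 ≤ k₀ ∧ ∀ k, k₀ ≤ k → depthQuotPow I k = depthQuotPow I k₀), (k₀ : ℕ∞)

/-- The analytic spread of `I`: the Krull dimension of the fiber ring `ℛ(I) / 𝔪 ℛ(I)`, where `ℛ(I)`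
is the Rees algebra of `I` and `𝔪` is the maximal graded ideal. -/
def analyticSpread {σ K : Type*} [Field K] (I : Ideal (MvPolynomial σ K)) : WithBot ℕ∞ :=
  ringKrullDim
    (reesAlgebra I ⧸ (idealOfVars σ K).map (algebraMap (MvPolynomial σ K) (reesAlgebra I)))

end MvPolynomial

end

/-!
Let `n` be the number of vertices of `H`. The minimal vertex covers of the whisker graph of `H`
correspond to the independent sets `F` of `H`, so `J = J(G)` is generated by the monomials
`m_F = ∏ v ∉ F, x_v * ∏ v ∈ F, y_v`. Hence `J ^ k` is generated by the monomials `x ^ (k - a) y ^ a`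
where `a` runs through the set `A_k` of sums of `k` indicator functions of independent sets
(`coverIdeal_whiskerGraph_pow`). The set `A_k` is closed under passing to smaller functions
(`isLowerSet_indepSums`), and contains every `a` with `∑ a ≤ k` since singletons are independent
(`mem_indepSums_of_sum_le`).

*Depth.* Fix a vertex `v₀`. The `n - 1` linear forms `y_v - y_{v₀}`, `v ≠ v₀`, form a regular
sequence on `S / J ^ k` (`isWeaklyRegular_X_sub_X`). Indeed, after identification of some of the
`y_v` with each other the ideal is still monomial, and it has no associated prime containing two
different variables `y_p`, `y_q`: this is a consequence of `A_k` being closed under pointwise minima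
(`mem_map_rename_of_X_sub_X_mul_mem`). If `k ≥ n`, then the function `1` and all smaller functions
lie in `A_k`, and once all `y_v` are identified `y_{v₀} ^ (n - 1) ∏ x_v ^ (k - 1)` is a socle element
of the quotient (`exists_annihilated_quotient_coverIdeal_pow`). So the regular sequence is of maximal
length, by the description of depth through `Ext` (`IsRegular.length_le_of_annihilated`). Thus the
depth of `S / J ^ k` is `n - 1` for all `k ≥ n`.

*Analytic spread.* All generators `m_F` have degree `n`. Comparing degrees, the subalgebra
`K[m_F t : F]` of `S[t]` maps isomorphically onto the fiber ring
(`ringKrullDim_reesAlgebra_quotient_eq`). It is a finitely generated domain, so its dimension is its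
transcendence degree (`IsTranscendenceBasis.ringKrullDim_eq_natCard`). The `n + 1` elements `m_∅ t`
and `m_{v} t` are algebraically independent, and the relations
`m_∅ * m_{F ∪ {v}} = m_{v} * m_F` show that they form a transcendence basis.
-/

/-! ### Krull dimension and transcendence bases -/

theorem LTSeries.exists_comap_last_eq_of_isIntegral {R S : Type*} [CommRing R] [CommRing S]
    [Algebra R S] [Algebra.IsIntegral R S] (h : Function.Injective (algebraMap R S))
    (p : LTSeries (PrimeSpectrum R)) :
    ∃ q : LTSeries (PrimeSpectrum S), q.length = p.length ∧
      PrimeSpectrum.comap (algebraMap R S) q.last = p.last := by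
  induction p using RelSeries.inductionOn' with
  | singleton x =>
    obtain ⟨Q, -, hQ, hQx⟩ := Ideal.exists_ideal_over_prime_of_isIntegral x.asIdeal (⊥ : Ideal S)
      (by rw [← RingHom.ker_eq_comap_bot, (RingHom.injective_iff_ker_eq_bot _).1 h]; exact bot_le)
    exact ⟨RelSeries.singleton _ ⟨Q, hQ⟩, rfl, PrimeSpectrum.ext hQx⟩
  | snoc p x hx ih =>
    obtain ⟨q, hlen, hq⟩ := ih
    have hlt : p.last < x := hx
    obtain ⟨Q, hQle, hQ, hQx⟩ := Ideal.exists_ideal_over_prime_of_isIntegral x.asIdeal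
      q.last.asIdeal (by
        have := congrArg PrimeSpectrum.asIdeal hq
        rw [PrimeSpectrum.comap_asIdeal] at this
        rw [this]
        exact hlt.le)
    have hq' : q.last < ⟨Q, hQ⟩ := by
      refine lt_of_le_of_ne hQle fun hne => hlt.ne ?_
      rw [← hq, hne]
      exact PrimeSpectrum.ext hQx
    refine ⟨q.snoc ⟨Q, hQ⟩ hq', ?_, ?_⟩
    · simp [hlen]
    · rw [RelSeries.last_snoc, RelSeries.last_snoc]
      exact PrimeSpectrum.ext hQx

theorem ringKrullDim_eq_of_isIntegral_of_injective {R S : Type*} [CommRing R] [CommRing S]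
    [Algebra R S] [Algebra.IsIntegral R S] (h : Function.Injective (algebraMap R S)) :
    ringKrullDim S = ringKrullDim R := by
  apply le_antisymm
  · refine Order.krullDim_le_of_strictMono (PrimeSpectrum.comap (algebraMap R S)) fun p q hpq => ?_
    exact Ideal.IsIntegral.comap_lt_comap (I := p.asIdeal) (J := q.asIdeal) hpq
  · refine iSup_le fun p => ?_
    obtain ⟨q, hlen, -⟩ := p.exists_comap_last_eq_of_isIntegral h
    rw [← hlen]
    exact Order.LTSeries.length_le_krullDim q

/-- The Krull dimension of a finitely generated domain over a field is its transcendence degree: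
Noether normalization provides one transcendence basis over whose polynomial ring the algebra is
integral, and all transcendence bases have the same cardinality. -/
theorem IsTranscendenceBasis.ringKrullDim_eq_natCard {k A ι : Type*} [Field k] [CommRing A]
    [IsDomain A] [Algebra k A] [Algebra.FiniteType k A] [Finite ι] {x : ι → A}
    (hx : IsTranscendenceBasis k x) : ringKrullDim A = (Nat.card ι : WithBot ℕ∞) := by
  obtain ⟨s, g, hg, hint⟩ := exists_integral_inj_algHom_of_fg k A
  algebraize [g.toRingHom]
  have : IsScalarTower k (MvPolynomial (Fin s) k) A := .of_algHom g
  have : FaithfulSMul (MvPolynomial (Fin s) k) A :=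
    (faithfulSMul_iff_algebraMap_injective _ _).2 hg
  have hb := (IsTranscendenceBasis.mvPolynomial (Fin s) k).algebraMap_comp (A := A)
  have hcard := congrArg Cardinal.toNat (hx.lift_cardinalMk_eq hb)
  rw [Cardinal.toNat_lift, Cardinal.toNat_lift] at hcard
  change Nat.card ι = Nat.card (Fin s) at hcard
  rw [ringKrullDim_eq_of_isIntegral_of_injective (R := MvPolynomial (Fin s) k) (S := A) hg,
    MvPolynomial.ringKrullDim_of_isNoetherianRing, ringKrullDim_eq_zero_of_field, hcard, zero_add]

/-! ### Maximal regular sequences -/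

section MaximalRegularSequence

open CategoryTheory Abelian RingTheory.Sequence

universe u

/-- The induction step is the long exact sequence of `Ext N` for multiplication by the first
element of `rs`. -/
theorem subsingleton_linearMap_quotient_of_subsingleton_ext {R : Type u} [CommRing R]
    (N : ModuleCat.{u} R) (rs : List R) (M : ModuleCat.{u} R) (hrs : IsWeaklyRegular M rs)
    (hext : ∀ i ≤ rs.length, Subsingleton (Ext N M i)) :
    Subsingleton (N →ₗ[R] (M ⧸ (Ideal.ofList rs • ⊤ : Submodule R M))) := by
  induction rs generalizing M with
  | nil =>
    have := hext 0 le_rfl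
    have : Subsingleton (N →ₗ[R] M) :=
      (Ext.addEquiv₀.trans ModuleCat.homAddEquiv).symm.subsingleton
    let e : (M ⧸ (Ideal.ofList [] • ⊤ : Submodule R M)) ≃ₗ[R] M :=
      Submodule.quotEquivOfEqBot _ 
        ((congrArg (· • (⊤ : Submodule R M)) Ideal.ofList_nil).trans (Submodule.bot_smul _))
    exact (LinearEquiv.congrRight e).toEquiv.subsingleton
  | cons r rs ih =>
    rw [isWeaklyRegular_cons_iff] at hrs
    have := ih (ModuleCat.of R (QuotSMulTop r M)) hrs.2 fun i hi => by
      have zero1 := AddCommGrpCat.isZero_of_iff_subsingleton.mpr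
        (hext i (by simp only [List.length_cons]; omega))
      have zero2 := AddCommGrpCat.isZero_of_iff_subsingleton.mpr
        (hext (i + 1) (by simp only [List.length_cons]; omega))
      exact AddCommGrpCat.subsingleton_of_isZero <| ShortComplex.Exact.isZero_of_both_zeros
        ((Ext.covariant_sequence_exact₃' N hrs.1.smulShortComplex_shortExact) i (i + 1) rfl)
        (zero1.eq_zero_of_src _) (zero2.eq_zero_of_tgt _)
    exact (LinearEquiv.congrRight
      (Submodule.quotOfListConsSMulTopEquivQuotSMulTopInner M r rs)).toEquiv.subsingleton

/-- A regular sequence `rs` in `I` for which some nonzero element of `M / (rs) M` is annihilated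
by `I` is a longest one: a longer one would force `Ext^i (R / I, M) = 0` for all `i ≤ rs.length`,
hence `Hom (R / I, M / (rs) M) = 0`. -/
theorem RingTheory.Sequence.IsRegular.length_le_of_annihilated {R M : Type u} [CommRing R]
    [IsNoetherianRing R] [AddCommGroup M] [Module R M] [Module.Finite R M] {I : Ideal R}
    {rs : List R} (hrs : IsWeaklyRegular M rs)
    (hu : ∃ u : M ⧸ (Ideal.ofList rs • ⊤ : Submodule R M), u ≠ 0 ∧ ∀ r ∈ I, r • u = 0)
    (hI : I • (⊤ : Submodule R M) ≠ ⊤)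
    {ss : List R} (hss : IsRegular M ss) (hmem : ∀ r ∈ ss, r ∈ I) : ss.length ≤ rs.length := by
  by_contra! hlt
  obtain ⟨u, hu0, hu⟩ := hu
  have hext := ModuleCat.subsingleton_ext_of_exists_isRegular I (ModuleCat.of R (R ⧸ I))
    (by rw [Module.support_eq_zeroLocus, Ideal.annihilator_quotient])
    (ModuleCat.of R M) hI.lt_top ss hmem hss
  have := subsingleton_linearMap_quotient_of_subsingleton_ext _ rs (ModuleCat.of R M) hrs
    fun i hi => hext i (by omega)
  let g : (R ⧸ I) →ₗ[R] (M ⧸ (Ideal.ofList rs • ⊤ : Submodule R M)) :=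
    Submodule.liftQ I (LinearMap.toSpanSingleton R _ u) fun r hr => hu r hr
  have hg : g = 0 := Subsingleton.elim (α := ModuleCat.of R (R ⧸ I) →ₗ[R]
    (ModuleCat.of R M ⧸ (Ideal.ofList rs • ⊤ : Submodule R (ModuleCat.of R M)))) g 0
  apply hu0
  have h1 : g (Submodule.Quotient.mk 1) = (1 : R) • u := rfl
  rw [hg, one_smul] at h1
  exact h1.symm

end MaximalRegularSequence

/-! ### Monomial ideals and differences of variables -/

namespace MvPolynomial

theorem coeff_X_sub_X_mul_eq {σ R : Type*} [CommRing R] {p q : σ} {f : MvPolynomial σ R}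
    {m m' : σ →₀ ℕ} (h : ∀ m'', m'' + Finsupp.single q 1 = m + Finsupp.single p 1 →
      coeff m'' f = 0)
    (hm : m + Finsupp.single p 1 = m') : coeff m' ((X p - X q) * f) = coeff m f := by
  classical
  subst hm
  rw [sub_mul, coeff_sub, add_comm m, coeff_X_mul, coeff_X_mul', sub_eq_self]
  split_ifs with hq
  · refine h _ (tsub_add_cancel_of_le ?_ |>.trans (add_comm _ _))
    rw [Finsupp.single_le_iff]
    exact Nat.one_le_iff_ne_zero.2 (Finsupp.mem_support_iff.1 hq)
  · rfl

/-- Comparing coefficients of `(X p - X q) * f` successively along the monomials obtained by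
trading factors `X q` for factors `X p`. -/
theorem coeff_eq_zero_of_X_sub_X_mul {σ R : Type*} [CommRing R] {p q : σ} (hpq : p ≠ q)
    {E : Set (σ →₀ ℕ)} (hE : IsUpperSet E) {f : MvPolynomial σ R}
    (hf : ∀ m ∈ ((X p - X q) * f).support, m ∈ E) (m : σ →₀ ℕ)
    (hm : ∀ s, m + Finsupp.single p s ∉ E) : coeff m f = 0 := by
  induction hc : m q generalizing m with
  | zero =>
    rw [← coeff_X_sub_X_mul_eq (p := p) (q := q) _ rfl]
    · exact notMem_support_iff.1 fun h => hm 1 (hf _ h)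
    · intro m'' h
      have := DFunLike.congr_fun h q
      simp [hpq, hc] at this
  | succ c ih =>
    rw [← coeff_X_sub_X_mul_eq (p := p) (q := q) _ rfl]
    · exact notMem_support_iff.1 fun h => hm 1 (hf _ h)
    · intro m'' h
      apply ih
      · intro s hs
        refine hm (s + 1) (hE ?_ hs)
        rw [add_comm s 1, Finsupp.single_add, ← add_assoc, ← h]
        gcongr
        exact le_self_add
      · have := DFunLike.congr_fun h q
        simp [hpq, hc] at this
        exact this

/-- If no monomial outside the monomial ideal `I` can be multiplied into `I` both by a power of
`X p` and by a power of `X q`, then `X p - X q` is a nonzerodivisor modulo `I`. For finitely many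
variables the hypothesis says that no associated prime of `I` contains both `X p` and `X q`. -/
theorem mem_of_X_sub_X_mul_mem {σ R : Type*} [CommRing R] {p q : σ} (hpq : p ≠ q)
    {E : Set (σ →₀ ℕ)} (hE : IsUpperSet E) {I : Ideal (MvPolynomial σ R)}
    (hI : ∀ f, f ∈ I ↔ ∀ m ∈ f.support, m ∈ E)
    (h : ∀ m s t, m + Finsupp.single p s ∈ E → m + Finsupp.single q t ∈ E → m ∈ E)
    {f : MvPolynomial σ R} (hf : (X p - X q) * f ∈ I) : f ∈ I := by
  rw [hI]
  intro m hm
  by_contra hmE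
  rw [mem_support_iff] at hm
  by_cases hp : ∀ s, m + Finsupp.single p s ∉ E
  · exact hm (coeff_eq_zero_of_X_sub_X_mul hpq hE ((hI _).1 hf) m hp)
  · push Not at hp
    obtain ⟨s, hs⟩ := hp
    have hf' : (X q - X p) * f ∈ I := by
      have := I.neg_mem hf
      rwa [← neg_mul, neg_sub] at this
    exact hm (coeff_eq_zero_of_X_sub_X_mul hpq.symm hE ((hI _).1 hf') m
      fun t ht => hmE (h m s t hs ht))

theorem sub_rename_mem {σ R : Type*} [CommRing R] {D : Ideal (MvPolynomial σ R)} {c : σ → σ}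
    (hD : ∀ v, (X v - X (c v) : MvPolynomial σ R) ∈ D) (f : MvPolynomial σ R) :
    f - rename c f ∈ D := by
  have : (Ideal.Quotient.mkₐ R D).comp (rename c) = Ideal.Quotient.mkₐ R D := by
    ext v
    simpa using ((Ideal.Quotient.eq (I := D)).2 (hD v)).symm
  exact (Ideal.Quotient.eq (I := D)).1 (DFunLike.congr_fun this f).symm

/-- Modulo the differences `X v - X (c v)`, an ideal may be replaced by the ideal in which every
variable `X v` is specialised to `X (c v)`. -/
theorem mem_sup_iff_rename_mem_map {σ R : Type*} [CommRing R] {I D : Ideal (MvPolynomial σ R)}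
    {c : σ → σ} (hD : ∀ v, (X v - X (c v) : MvPolynomial σ R) ∈ D)
    (hD' : ∀ f ∈ D, rename c f = 0) (f : MvPolynomial σ R) :
    f ∈ I ⊔ D ↔ rename c f ∈ I.map (rename (R := R) c) := by
  constructor
  · intro hf
    obtain ⟨a, ha, b, hb, rfl⟩ := Submodule.mem_sup.1 hf
    rw [map_add, hD' b hb, add_zero]
    exact Ideal.mem_map_of_mem _ ha
  · intro hf
    have hle : I.map (rename (R := R) c) ≤ I ⊔ D := by
      rw [Ideal.map_le_iff_le_comap]
      intro g hg
      have := (I ⊔ D).sub_mem (Ideal.mem_sup_left hg) (Ideal.mem_sup_right (sub_rename_mem hD g))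
      rwa [sub_sub_cancel] at this
    have := (I ⊔ D).add_mem (Ideal.mem_sup_right (sub_rename_mem hD f)) (hle hf)
    rwa [sub_add_cancel] at this

end MvPolynomial

theorem Ideal.mk_mem_smul_top_iff {R : Type*} [CommRing R] (I D : Ideal R) (f : R) :
    (Submodule.Quotient.mk f : R ⧸ I) ∈ (D • ⊤ : Submodule R (R ⧸ I)) ↔ f ∈ I ⊔ D := by
  have h : (D • ⊤ : Submodule R (R ⧸ I)) = Submodule.map (Submodule.mkQ I) D := by
    conv_rhs => rw [← Ideal.mul_top D, ← smul_eq_mul, Submodule.map_smul'', Submodule.map_top,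
      Submodule.range_mkQ]
  rw [h, ← Submodule.comap_map_mkQ]
  rfl

/-! ### Powers of the cover ideal of a whisker graph -/

namespace SimpleGraph

/-- The sums of `k` indicator functions of independent sets of `H`: the exponents of the variables
`y_v` in the products of `k` generators of the cover ideal of the whisker graph. -/
def indepSums {V : Type*} (H : SimpleGraph V) : ℕ → Set (V → ℕ)
  | 0 => {0}
  | k + 1 => {a | ∃ b ∈ H.indepSums k, ∃ F : Set V, H.IsIndepSet F ∧ a = b + F.indicator 1}

/-- The exponent of the monomial `∏ v, x_v ^ (k - a v) * y_v ^ a v`. The subtraction is truncated;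
only functions `a ≤ k` are of interest. -/
noncomputable def whiskerExponent {V : Type*} [Finite V] (k : ℕ) (a : V → ℕ) : V ⊕ V →₀ ℕ :=
  Finsupp.equivFunOnFinite.symm (Sum.elim (fun v => k - a v) a)

@[simp]
theorem whiskerExponent_inl {V : Type*} [Finite V] (k : ℕ) (a : V → ℕ) (v : V) :
    whiskerExponent k a (Sum.inl v) = k - a v := rfl

@[simp]
theorem whiskerExponent_inr {V : Type*} [Finite V] (k : ℕ) (a : V → ℕ) (v : V) :
    whiskerExponent k a (Sum.inr v) = a v := rfl

theorem indicator_one_le_one {V : Type*} (F : Set V) (v : V) : F.indicator (1 : V → ℕ) v ≤ 1 :=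
  Set.indicator_le' (fun _ _ => le_rfl) (fun _ _ => zero_le_one) v

theorem le_of_mem_indepSums {V : Type*} {H : SimpleGraph V} {k : ℕ} {a : V → ℕ}
    (ha : a ∈ H.indepSums k) (v : V) : a v ≤ k := by
  induction k generalizing a with
  | zero => rw [show a = 0 from ha]; rfl
  | succ k ih =>
    obtain ⟨b, hb, F, -, rfl⟩ := ha
    exact add_le_add (ih hb) (indicator_one_le_one F v)

theorem isLowerSet_indepSums {V : Type*} (H : SimpleGraph V) (k : ℕ) :
    IsLowerSet (H.indepSums k) := by
  induction k with
  | zero =>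
    intro a b hba ha
    rw [show a = 0 from ha] at hba
    exact le_antisymm hba fun v => Nat.zero_le _
  | succ k ih =>
    rintro a b hba ⟨c, hc, F, hF, rfl⟩
    -- `b ⊓ c` differs from `b ≤ c + 1_F` by the indicator function of a subset of `F`.
    refine ⟨b ⊓ c, ih inf_le_right hc, {v | c v < b v}, ?_, ?_⟩
    · refine hF.mono fun v hv => ?_
      by_contra hvF
      have := hba v
      rw [Pi.add_apply, Set.indicator_of_notMem hvF] at this
      exact absurd hv (not_lt.2 this)
    · funext v
      have h1 : b v ≤ c v + F.indicator 1 v := hba v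
      have h2 := indicator_one_le_one F v
      rw [Pi.add_apply]
      by_cases hv : c v < b v
      · rw [Set.indicator_of_mem (show v ∈ {v | c v < b v} from hv)]
        rw [Pi.inf_apply, Pi.one_apply, inf_eq_right.2 hv.le]
        omega
      · rw [Set.indicator_of_notMem (show v ∉ {v | c v < b v} from hv)]
        rw [Pi.inf_apply, inf_eq_left.2 (not_lt.1 hv), add_zero]

theorem mem_indepSums_of_sum_le {V : Type*} [Fintype V] (H : SimpleGraph V) {k : ℕ} {a : V → ℕ}
    (ha : ∑ v, a v ≤ k) : a ∈ H.indepSums k := by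
  classical
  induction k generalizing a with
  | zero =>
    funext v
    exact Finset.sum_eq_zero_iff.1 (Nat.le_zero.1 ha) v (Finset.mem_univ v)
  | succ k ih =>
    by_cases h0 : ∀ v, a v = 0
    · refine ⟨0, ih (by simp), ∅, Set.pairwise_empty _, ?_⟩
      funext v
      simp [h0 v]
    · push Not at h0
      obtain ⟨v, hv⟩ := h0
      refine ⟨a - Pi.single v 1, ih ?_, {v}, Set.pairwise_singleton _ _, ?_⟩
      · have h1 : a = (a - Pi.single v 1) + Pi.single v 1 := by
          refine (tsub_add_cancel_of_le fun w => ?_).symm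
          by_cases hw : w = v
          · subst hw
            simpa using Nat.one_le_iff_ne_zero.2 hv
          · simp [hw]
        have h2 : ∑ w, a w = ∑ w, (a - Pi.single v 1 : V → ℕ) w + 1 := by
          conv_lhs => rw [h1]
          simp [Finset.sum_add_distrib]
        omega
      · funext w
        by_cases hw : w = v
        · subst hw
          simp
          omega
        · simp [hw]

theorem isMinimalVertexCover_whiskerGraph_iff {V : Type*} [Fintype V] [DecidableEq V]
    (H : SimpleGraph V) (C : Finset (V ⊕ V)) :
    H.whiskerGraph.IsMinimalVertexCover C ↔
      ∃ F : Finset V, H.IsIndepSet (F : Set V) ∧ C = Fᶜ.disjSum F := by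
  constructor
  · intro hC
    have hcov : ∀ {u w}, H.whiskerGraph.Adj u w → u ∈ C ∨ w ∈ C := fun h => hC.prop h
    -- If `x_v` is in the cover, then `y_v` can be removed, as `x_v y_v` is the only edge at `y_v`.
    have hx : ∀ v, Sum.inr v ∈ C → Sum.inl v ∉ C := by
      intro v hr hl
      refine Finset.notMem_erase (Sum.inr v) C (hC.le_of_le (y := C.erase (Sum.inr v)) ?_
        (Finset.erase_subset _ _) hr)
      intro u w h
      rcases u with u | u <;> rcases w with w | w
      · simpa using! hcov h
      · obtain rfl : u = w := h
        by_cases huv : u = v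
        · subst huv
          left
          simpa using! hl
        · simpa [huv] using! hcov (show H.whiskerGraph.Adj (Sum.inl u) (Sum.inr u) from rfl)
      · obtain rfl : u = w := h
        by_cases huv : u = v
        · subst huv
          right
          simpa using! hl
        · simpa [huv] using! hcov (show H.whiskerGraph.Adj (Sum.inr u) (Sum.inl u) from rfl)
      · exact h.elim
    have hy : ∀ v, Sum.inl v ∈ C ↔ Sum.inr v ∉ C := fun v =>
      ⟨fun hl hr => hx v hr hl, fun hr =>
        (hcov (show H.whiskerGraph.Adj (Sum.inl v) (Sum.inr v) from rfl)).resolve_right hr⟩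
    refine ⟨Finset.univ.filter fun v => Sum.inr v ∈ C, ?_, ?_⟩
    · intro u hu w hw _ huw
      simp only [Finset.coe_filter, Finset.mem_univ, true_and, Set.mem_ofPred_eq] at hu hw
      rcases hcov (show H.whiskerGraph.Adj (Sum.inl u) (Sum.inl w) from huw) with h | h
      · exact hx u hu h
      · exact hx w hw h
    · ext (v | v)
      · simp [hy]
      · simp
  · rintro ⟨F, hF, rfl⟩
    constructor
    · rintro (u | u) (w | w) h
      · have huw : H.Adj u w := h
        by_contra hcon
        simp only [Finset.mem_coe, Finset.inl_mem_disjSum, Finset.mem_compl, not_or,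
          not_not] at hcon
        exact hF hcon.1 hcon.2 huw.ne huw
      · obtain rfl : u = w := h
        simpa using (em (u ∈ F)).symm
      · obtain rfl : u = w := h
        simpa using em (u ∈ F)
      · exact h.elim
    · rintro D hD hle (v | v) hv
      · rcases hD (show H.whiskerGraph.Adj (Sum.inl v) (Sum.inr v) from rfl) with h | h
        · exact h
        · have := hle h
          simp_all
      · rcases hD (show H.whiskerGraph.Adj (Sum.inl v) (Sum.inr v) from rfl) with h | h
        · have := hle h
          simp_all
        · exact h

theorem prod_X_disjSum_eq_monomial {V K : Type*} [Fintype V] [DecidableEq V] [Field K]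
    (F : Finset V) : ∏ v ∈ Fᶜ.disjSum F, (MvPolynomial.X v : MvPolynomial (V ⊕ V) K) =
      MvPolynomial.monomial (whiskerExponent 1 ((F : Set V).indicator 1)) 1 := by
  simp only [MvPolynomial.X]
  rw [← MvPolynomial.monomial_sum_one]
  refine congrArg (fun m => MvPolynomial.monomial m (1 : K)) (Finsupp.ext ?_)
  rintro (v | v) <;> by_cases hv : v ∈ F <;>
    simp [Finset.sum_disjSum, Finsupp.single_apply, hv]

theorem coverIdeal_whiskerGraph_eq_span {V K : Type*} [Finite V] [Field K] (H : SimpleGraph V) :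
    H.whiskerGraph.coverIdeal K = Ideal.span ((fun m => MvPolynomial.monomial m (1 : K)) ''
      {m | ∃ F : Set V, H.IsIndepSet F ∧ m = whiskerExponent 1 (F.indicator 1)}) := by
  classical
  have := Fintype.ofFinite V
  refine congrArg Ideal.span (Set.ext fun u => ⟨?_, ?_⟩)
  · rintro ⟨C, hC, rfl⟩
    obtain ⟨F, hF, rfl⟩ := (isMinimalVertexCover_whiskerGraph_iff H C).1 hC
    exact ⟨_, ⟨F, hF, rfl⟩, (prod_X_disjSum_eq_monomial F).symm⟩
  · rintro ⟨_, ⟨F, hF, rfl⟩, rfl⟩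
    refine ⟨_, (isMinimalVertexCover_whiskerGraph_iff H _).2 ⟨F.toFinset, by simpa, rfl⟩, ?_⟩
    rw [prod_X_disjSum_eq_monomial, Set.coe_toFinset]

theorem whiskerExponent_add {V : Type*} [Finite V] {k l : ℕ} {a b : V → ℕ} (ha : ∀ v, a v ≤ k)
    (hb : ∀ v, b v ≤ l) :
    whiskerExponent k a + whiskerExponent l b = whiskerExponent (k + l) (a + b) := by
  ext (v | v)
  · have := ha v
    have := hb v
    simp
    omega
  · simp

theorem coverIdeal_whiskerGraph_pow {V K : Type*} [Finite V] [Field K] (H : SimpleGraph V)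
    (k : ℕ) : H.whiskerGraph.coverIdeal K ^ k = Ideal.span
      ((fun m => MvPolynomial.monomial m (1 : K)) '' (whiskerExponent k '' H.indepSums k)) := by
  induction k with
  | zero =>
    have h : whiskerExponent 0 (0 : V → ℕ) = 0 := by
      ext (v | v) <;> simp
    simp [indepSums, h, Ideal.one_eq_top]
  | succ k ih =>
    rw [pow_succ, ih, coverIdeal_whiskerGraph_eq_span, Ideal.span_mul_span']
    refine congrArg Ideal.span (Set.ext fun u => ⟨?_, ?_⟩)
    · rintro ⟨_, ⟨_, ⟨b, hb, rfl⟩, rfl⟩, _, ⟨_, ⟨F, hF, rfl⟩, rfl⟩, rfl⟩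
      refine ⟨_, ⟨_, ⟨b, hb, F, hF, rfl⟩, rfl⟩, ?_⟩
      simp [← whiskerExponent_add (le_of_mem_indepSums hb) (indicator_one_le_one F),
        MvPolynomial.monomial_mul]
    · rintro ⟨_, ⟨_, ⟨b, hb, F, hF, rfl⟩, rfl⟩, rfl⟩
      refine ⟨_, ⟨_, ⟨b, hb, rfl⟩, rfl⟩, _, ⟨_, ⟨F, hF, rfl⟩, rfl⟩, ?_⟩
      simp [← whiskerExponent_add (le_of_mem_indepSums hb) (indicator_one_le_one F),
        MvPolynomial.monomial_mul]

end SimpleGraph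

/-! ### Depth of the powers -/

namespace SimpleGraph

open MvPolynomial

theorem degree_whiskerExponent {V : Type*} [Fintype V] {k : ℕ} {a : V → ℕ} (ha : ∀ v, a v ≤ k) :
    (whiskerExponent k a).degree = Fintype.card V * k := by
  rw [Finsupp.degree_eq_sum, Fintype.sum_sum_type, ← Finset.sum_add_distrib]
  simp [ha]

theorem coverIdeal_whiskerGraph_pow_le {V K : Type*} [Fintype V] [Field K] (H : SimpleGraph V)
    (k : ℕ) : H.whiskerGraph.coverIdeal K ^ k ≤ idealOfVars (V ⊕ V) K ^ (Fintype.card V * k) := by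
  rw [coverIdeal_whiskerGraph_pow, Ideal.span_le]
  rintro _ ⟨_, ⟨a, ha, rfl⟩, rfl⟩
  exact (monomial_mem_pow_idealOfVars_iff _ _ one_ne_zero).2
    (degree_whiskerExponent (le_of_mem_indepSums ha)).ge

theorem mapDomain_whiskerExponent_le_iff {V : Type*} [Fintype V] [DecidableEq V] (τ : V → V)
    (k : ℕ) (a : V → ℕ) (m : V ⊕ V →₀ ℕ) :
    (whiskerExponent k a).mapDomain (Sum.map id τ) ≤ m ↔
      (∀ v, k - a v ≤ m (Sum.inl v)) ∧
        ∀ w, ∑ v with τ v = w, a v ≤ m (Sum.inr w) := by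
  have h : ∀ x, (whiskerExponent k a).mapDomain (Sum.map id τ) x =
      ∑ y, if Sum.map id τ y = x then whiskerExponent k a y else 0 := by
    intro x
    rw [Finsupp.mapDomain, Finsupp.sum_fintype _ _ (by simp), Finsupp.finsetSum_apply]
    simp [Finsupp.single_apply]
  rw [Finsupp.le_def, Sum.forall]
  refine and_congr (forall_congr' fun v => ?_) (forall_congr' fun w => ?_)
  · rw [h]
    simp [Fintype.sum_sum_type]
  · rw [h]
    simp [Fintype.sum_sum_type, Finset.sum_filter]

/-- The image of `J ^ k` under a substitution of variables `y_v ↦ y_{τ v}` is the monomial ideal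
generated by the images of the generators. -/
theorem mem_map_rename_coverIdeal_pow_iff {V K : Type*} [Fintype V] [DecidableEq V] [Field K]
    (H : SimpleGraph V) (τ : V → V) (k : ℕ) (f : MvPolynomial (V ⊕ V) K) :
    f ∈ (H.whiskerGraph.coverIdeal K ^ k).map (rename (R := K) (Sum.map id τ)) ↔
      ∀ m ∈ f.support, ∃ a ∈ H.indepSums k, (∀ v, k - a v ≤ m (Sum.inl v)) ∧
        ∀ w, ∑ v with τ v = w, a v ≤ m (Sum.inr w) := by
  have h : (H.whiskerGraph.coverIdeal K ^ k).map (rename (R := K) (Sum.map id τ)) =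
      Ideal.span ((fun m => monomial m (1 : K)) ''
        ((fun a => (whiskerExponent k a).mapDomain (Sum.map id τ)) '' H.indepSums k)) := by
    rw [coverIdeal_whiskerGraph_pow, Ideal.map_span]
    simp only [Set.image_image, rename_monomial]
  rw [h, mem_ideal_span_monomial_image]
  simp only [Set.exists_mem_image, mapDomain_whiskerExponent_le_iff]

/-- Two exponents witnessing that a monomial lies in the ideal after multiplication by a power of
`y_p`, respectively of `y_q`, have as their pointwise minimum an exponent witnessing that the
monomial itself lies in the ideal. -/
theorem mem_map_rename_of_X_sub_X_mul_mem {V K : Type*} [Fintype V] [Field K]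
    (H : SimpleGraph V) (τ : V → V) (k : ℕ) {p q : V} (hpq : p ≠ q) {f : MvPolynomial (V ⊕ V) K}
    (hf : (X (Sum.inr p) - X (Sum.inr q)) * f ∈
      (H.whiskerGraph.coverIdeal K ^ k).map (rename (R := K) (Sum.map id τ))) :
    f ∈ (H.whiskerGraph.coverIdeal K ^ k).map (rename (R := K) (Sum.map id τ)) := by
  classical
  refine mem_of_X_sub_X_mul_mem (Sum.inr_injective.ne hpq)
    (E := {m | ∃ a ∈ H.indepSums k, (∀ v, k - a v ≤ m (Sum.inl v)) ∧
        ∀ w, ∑ v with τ v = w, a v ≤ m (Sum.inr w)})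
    ?_ (mem_map_rename_coverIdeal_pow_iff H τ k) ?_ hf
  · rintro m m' hmm ⟨a, ha, h1, h2⟩
    exact ⟨a, ha, fun v => (h1 v).trans (hmm _), fun w => (h2 w).trans (hmm _)⟩
  · rintro m s t ⟨a, ha, ha1, ha2⟩ ⟨b, hb, hb1, hb2⟩
    refine ⟨a ⊓ b, H.isLowerSet_indepSums k inf_le_left ha, fun v => ?_, fun w => ?_⟩
    · have h1 := ha1 v
      have h2 := hb1 v
      simp only [Finsupp.add_apply, Finsupp.single_apply, reduceCtorEq, if_false,
        add_zero] at h1 h2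
      rcases le_total (a v) (b v) with h | h
      · rwa [Pi.inf_apply, inf_eq_left.2 h]
      · rwa [Pi.inf_apply, inf_eq_right.2 h]
    · by_cases hw : w = p
      · refine (Finset.sum_le_sum fun v _ => (inf_le_right : a ⊓ b ≤ b) v).trans ?_
        have := hb2 w
        rwa [Finsupp.add_apply, Finsupp.single_eq_of_ne, add_zero] at this
        subst hw
        exact Sum.inr_injective.ne hpq
      · refine (Finset.sum_le_sum fun v _ => (inf_le_left : a ⊓ b ≤ a) v).trans ?_
        have := ha2 w
        rwa [Finsupp.add_apply, Finsupp.single_eq_of_ne, add_zero] at this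
        exact Sum.inr_injective.ne hw

/-- Modulo the linear forms `y_v - y_{v₀}` with `v ∈ l`, membership in `J ^ k` can be tested after
substituting `y_{v₀}` for all `y_v` with `v ∈ l`. -/
theorem mem_coverIdeal_pow_sup_ofList_iff {V K : Type*} [Fintype V] [DecidableEq V] [Field K]
    (H : SimpleGraph V) (k : ℕ) (v₀ : V) (l : List V) (f : MvPolynomial (V ⊕ V) K) :
    f ∈ H.whiskerGraph.coverIdeal K ^ k ⊔
        Ideal.ofList (l.map fun v => X (Sum.inr v) - X (Sum.inr v₀)) ↔
      rename (Sum.map id fun v => if v ∈ l then v₀ else v) f ∈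
        (H.whiskerGraph.coverIdeal K ^ k).map
          (rename (R := K) (Sum.map id fun v => if v ∈ l then v₀ else v)) := by
  refine mem_sup_iff_rename_mem_map ?_ ?_ f
  · rintro (v | v)
    · simp
    · by_cases hv : v ∈ l
      · simp only [Sum.map_inr, if_pos hv]
        exact Ideal.subset_span (List.mem_map.2 ⟨v, hv, rfl⟩)
      · simp [hv]
  · intro g hg
    have hle : Ideal.ofList (l.map fun v => X (Sum.inr v) - X (Sum.inr v₀)) ≤
        RingHom.ker (rename (R := K) (Sum.map id fun v => if v ∈ l then v₀ else v) :
          MvPolynomial (V ⊕ V) K →ₐ[K] MvPolynomial (V ⊕ V) K) := by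
      rw [Ideal.span_le]
      intro r hr
      obtain ⟨v, hv, rfl⟩ := List.mem_map.1 hr
      simp [RingHom.mem_ker, hv]
    exact hle hg

theorem isWeaklyRegular_X_sub_X {V K : Type*} [Fintype V] [Field K] (H : SimpleGraph V) (k : ℕ)
    (v₀ : V) (l : List V) (hl : l.Nodup) (hv₀ : v₀ ∉ l) :
    RingTheory.Sequence.IsWeaklyRegular
      (MvPolynomial (V ⊕ V) K ⧸ H.whiskerGraph.coverIdeal K ^ k)
      (l.map fun v => (X (Sum.inr v) - X (Sum.inr v₀) : MvPolynomial (V ⊕ V) K)) := by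
  classical
  refine ⟨fun i hi => ?_⟩
  rw [isSMulRegular_quotient_iff_mem_of_smul_mem]
  intro x hx
  obtain ⟨f, rfl⟩ := Submodule.Quotient.mk_surjective _ x
  rw [← Submodule.Quotient.mk_smul, Ideal.mk_mem_smul_top_iff, ← List.map_take,
    mem_coverIdeal_pow_sup_ofList_iff] at hx
  rw [Ideal.mk_mem_smul_top_iff, ← List.map_take, mem_coverIdeal_pow_sup_ofList_iff]
  rw [List.length_map] at hi
  have h1 : l[i] ∉ l.take i := by
    intro h
    obtain ⟨j, hj, hji⟩ := List.mem_take_iff_getElem.1 h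
    have := (hl.getElem_inj_iff).1 hji
    omega
  have h2 : v₀ ≠ l[i] := fun h => hv₀ (h ▸ List.getElem_mem hi)
  refine mem_map_rename_of_X_sub_X_mul_mem H _ k h2.symm ?_
  simpa [h1] using hx

/-- Once all the `y_v` are identified with `y_{v₀}`, the monomial `y_{v₀} ^ (n - 1) ∏ x_v ^ (k - 1)`
is a socle element: it is not in the ideal, since the exponents `a` of the generators dividing it
would satisfy `a ≥ 1` and `∑ a ≤ n - 1`, but its product with any variable is. -/
theorem exists_annihilated_quotient_coverIdeal_pow {V K : Type*} [Fintype V] [Field K]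
    (H : SimpleGraph V) {k : ℕ} (v₀ : V) (hk : Fintype.card V ≤ k) (l : List V)
    (hl : ∀ v, v ∈ l ↔ v ≠ v₀) :
    ∃ u : (MvPolynomial (V ⊕ V) K ⧸ H.whiskerGraph.coverIdeal K ^ k) ⧸
        (Ideal.ofList (l.map fun v => (X (Sum.inr v) - X (Sum.inr v₀) :
          MvPolynomial (V ⊕ V) K)) • ⊤ : Submodule (MvPolynomial (V ⊕ V) K)
          (MvPolynomial (V ⊕ V) K ⧸ H.whiskerGraph.coverIdeal K ^ k)),
      u ≠ 0 ∧ ∀ r ∈ idealOfVars (V ⊕ V) K, r • u = 0 := by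
  classical
  have hτ : (fun v => if v ∈ l then v₀ else v) = fun _ => v₀ := by
    funext v
    by_cases hv : v = v₀ <;> simp [hl, hv]
  have hcard : 0 < Fintype.card V := Fintype.card_pos_iff.2 ⟨v₀⟩
  let w : V ⊕ V →₀ ℕ := Finsupp.equivFunOnFinite.symm
    (Sum.elim (fun _ => k - 1) (Pi.single v₀ (Fintype.card V - 1)))
  have hwl : ∀ v, w (Sum.inl v) = k - 1 := fun _ => rfl
  have hwr : ∀ v, w (Sum.inr v) = (Pi.single v₀ (Fintype.card V - 1) : V → ℕ) v := fun _ => rfl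
  have hmap : w.mapDomain (Sum.map id fun _ => v₀) = w := by
    have : w.mapDomain (Sum.map id fun _ => v₀) = w.mapDomain id := by
      refine Finsupp.mapDomain_congr ?_
      rintro (v | v) hv
      · rfl
      · have : v = v₀ := by
          by_contra hne
          exact Finsupp.mem_support_iff.1 hv (by rw [hwr, Pi.single_eq_of_ne hne])
        rw [this]
        rfl
    rw [this, Finsupp.mapDomain_id]
  refine ⟨Submodule.Quotient.mk (Submodule.Quotient.mk (monomial w 1)), ?_, ?_⟩
  · rw [Ne, Submodule.Quotient.mk_eq_zero, Ideal.mk_mem_smul_top_iff,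
      mem_coverIdeal_pow_sup_ofList_iff, hτ, rename_monomial, hmap,
      mem_map_rename_coverIdeal_pow_iff]
    intro h
    obtain ⟨a, ha, h1, h2⟩ := h w (by simp [support_monomial])
    have h3 : ∀ v, 1 ≤ a v := by
      intro v
      have := h1 v
      rw [hwl] at this
      omega
    have h4 := h2 v₀
    rw [hwr, Pi.single_eq_same, Finset.filter_true_of_mem (fun _ _ => rfl)] at h4
    have h5 : Fintype.card V ≤ ∑ v, a v := by
      simpa using Finset.sum_le_sum fun v (_ : v ∈ Finset.univ) => h3 v
    omega
  · have key : ∀ x : V ⊕ V, (X x : MvPolynomial (V ⊕ V) K) •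
        (Submodule.Quotient.mk (Submodule.Quotient.mk (monomial w 1)) :
          (MvPolynomial (V ⊕ V) K ⧸ H.whiskerGraph.coverIdeal K ^ k) ⧸
        (Ideal.ofList (l.map fun v => (X (Sum.inr v) - X (Sum.inr v₀) :
          MvPolynomial (V ⊕ V) K)) • ⊤ : Submodule (MvPolynomial (V ⊕ V) K)
          (MvPolynomial (V ⊕ V) K ⧸ H.whiskerGraph.coverIdeal K ^ k))) = 0 := by
      intro x
      rw [← Submodule.Quotient.mk_smul, ← Submodule.Quotient.mk_smul, Submodule.Quotient.mk_eq_zero,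
        Ideal.mk_mem_smul_top_iff, mem_coverIdeal_pow_sup_ofList_iff, hτ, smul_eq_mul, map_mul,
        rename_monomial, hmap, rename_X, mem_map_rename_coverIdeal_pow_iff, X, monomial_mul]
      intro m hm
      have hm' : m = Finsupp.single (Sum.map id (fun _ => v₀) x) 1 + w := by
        simpa using support_monomial_subset hm
      subst hm'
      rcases x with x | x
      · refine ⟨1 - Pi.single x 1, H.mem_indepSums_of_sum_le ?_, fun v => ?_, fun v => ?_⟩
        · refine (Finset.sum_le_sum fun v _ => (tsub_le_self : (1 : V → ℕ) - _ ≤ 1) v).trans ?_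
          simpa
        · by_cases hv : v = x
          · subst hv
            simp [hwl]
            omega
          · simp [hwl, hv]
        · by_cases hv : v = v₀
          · subst hv
            rw [Finset.filter_true_of_mem (fun _ _ => rfl)]
            have h1 : ∑ v, ((1 : V → ℕ) - Pi.single x 1 : V → ℕ) v + 1 = Fintype.card V := by
              rw [← Finset.add_sum_erase _ _ (Finset.mem_univ x)]
              rw [Finset.sum_congr rfl (g := fun _ => 1)]
              · simp
                omega
              · intro v hv
                simp [Finset.ne_of_mem_erase hv]
            simp only [Finsupp.add_apply, hwr, Pi.single_eq_same]
            omega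
          · rw [Finset.filter_false_of_mem (fun _ _ => Ne.symm hv)]
            simp
      · refine ⟨1, H.mem_indepSums_of_sum_le (by simpa), fun v => ?_, fun v => ?_⟩
        · simp [hwl]
        · by_cases hv : v = v₀
          · subst hv
            rw [Finset.filter_true_of_mem (fun _ _ => rfl)]
            simp [hwr]
            omega
          · rw [Finset.filter_false_of_mem (fun _ _ => Ne.symm hv)]
            simp
    intro r hr
    refine Submodule.span_induction (p := fun r _ => r • _ = _) ?_ ?_ ?_ ?_ hr
    · rintro _ ⟨x, rfl⟩
      exact key x
    · exact zero_smul _ _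
    · intro r s _ _ hr hs
      rw [add_smul, hr, hs, add_zero]
    · intro s r _ hr
      rw [smul_eq_mul, mul_smul, hr, smul_zero]

theorem depthQuotPow_coverIdeal_whiskerGraph {V K : Type*} [Fintype V] [Nonempty V] [Field K]
    (H : SimpleGraph V) {k : ℕ} (hk : Fintype.card V ≤ k) :
    depthQuotPow (H.whiskerGraph.coverIdeal K) k = ((Fintype.card V - 1 : ℕ) : ℕ∞) := by
  classical
  let v₀ : V := Classical.arbitrary V
  have hcard : 0 < Fintype.card V := Fintype.card_pos
  let l : List V := (Finset.univ.erase v₀).toList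
  have hl : ∀ v, v ∈ l ↔ v ≠ v₀ := by simp [l]
  have hreg := H.isWeaklyRegular_X_sub_X (K := K) k v₀ l (Finset.nodup_toList _)
    fun h => (hl v₀).1 h rfl
  have hu := H.exists_annihilated_quotient_coverIdeal_pow (K := K) v₀ hk l hl
  have hlen : (l.map fun v => (X (Sum.inr v) - X (Sum.inr v₀) :
      MvPolynomial (V ⊕ V) K)).length = Fintype.card V - 1 := by
    simp [l, Finset.card_erase_of_mem]
  have hlt : (1 : MvPolynomial (V ⊕ V) K) ∉ idealOfVars (V ⊕ V) K := by
    rw [← pow_one (idealOfVars _ _), mem_pow_idealOfVars_iff']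
    push Not
    exact ⟨0, by simp⟩
  apply le_antisymm
  · refine iSup_le fun rs => iSup_le fun hmem => iSup_le fun hrs => ?_
    rw [Nat.cast_le, ← hlen]
    refine RingTheory.Sequence.IsRegular.length_le_of_annihilated hreg hu ?_ hrs hmem
    intro htop
    have h1 : (Submodule.Quotient.mk 1 : MvPolynomial (V ⊕ V) K ⧸
        H.whiskerGraph.coverIdeal K ^ k) ∈ (idealOfVars (V ⊕ V) K • ⊤ :
          Submodule (MvPolynomial (V ⊕ V) K) _) := by
      rw [htop]
      exact Submodule.mem_top
    rw [Ideal.mk_mem_smul_top_iff, sup_eq_right.2] at h1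
    · exact hlt h1
    · exact (H.coverIdeal_whiskerGraph_pow_le k).trans
        (Ideal.pow_le_self (Nat.mul_pos hcard (hcard.trans_le hk)).ne')
  · rw [← hlen]
    refine le_iSup_of_le _ (le_iSup_of_le ?_ (le_iSup_of_le ⟨hreg, ?_⟩ le_rfl))
    · intro r hr
      obtain ⟨v, -, rfl⟩ := List.mem_map.1 hr
      exact Ideal.sub_mem _ (Ideal.subset_span ⟨_, rfl⟩) (Ideal.subset_span ⟨_, rfl⟩)
    · intro htop
      obtain ⟨u, hu0, -⟩ := hu
      refine hu0 ?_
      obtain ⟨x, rfl⟩ := Submodule.Quotient.mk_surjective _ u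
      rw [Submodule.Quotient.mk_eq_zero, ← htop]
      exact Submodule.mem_top

end SimpleGraph

/-! ### Transcendence bases of algebras with generators indexed by a simplicial complex -/

/-- Let `A` be generated by elements `m F`, indexed by the faces `F` of a simplicial complex, with
`m ∅ * m (F ∪ {v}) = m {v} * m F`. By induction on `F` these relations make every `m F` algebraic
over the subalgebra generated by `m ∅` and the `m {v}`. -/
theorem AlgebraicIndependent.isTranscendenceBasis_of_insert_mul {K A V : Type*} [Field K]
    [CommRing A] [IsDomain A] [Algebra K A] [Finite V] {P : Set V → Prop}
    (hP : ∀ {F G : Set V}, F ⊆ G → P G → P F) (m : ∀ F, P F → A) (h0 : P ∅) (h1 : ∀ v, P {v})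
    (hmul : ∀ v F (_ : v ∉ F) (h : P (insert v F)),
      m ∅ h0 * m (insert v F) h = m {v} (h1 v) * m F (hP (Set.subset_insert v F) h))
    (htop : Algebra.adjoin K {a | ∃ F h, m F h = a} = ⊤) {x : Option V → A}
    (hnone : x none = m ∅ h0) (hsome : ∀ v, x (some v) = m {v} (h1 v))
    (hx : AlgebraicIndependent K x) : IsTranscendenceBasis K x := by
  rw [hx.isTranscendenceBasis_iff_isAlgebraic]
  have hbasis : ∀ o, IsAlgebraic (Algebra.adjoin K (Set.range x)) (x o) := fun o =>
    isAlgebraic_algebraMap (A := A)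
      (⟨x o, Algebra.subset_adjoin ⟨o, rfl⟩⟩ : Algebra.adjoin K (Set.range x))
  have hne : m ∅ h0 ≠ 0 := hnone ▸ hx.ne_zero none
  refine ⟨fun a => ?_⟩
  have ha : a ∈ Algebra.adjoin K {a | ∃ F h, m F h = a} := htop ▸ Algebra.mem_top
  induction ha using Algebra.adjoin_induction with
  | mem a ha =>
    obtain ⟨F, hF, rfl⟩ := ha
    induction F, Set.toFinite F using Set.Finite.induction_on with
    | empty => exact hnone ▸ hbasis none
    | @insert v F hv _ ih =>
      refine IsAlgebraic.of_mul (mem_nonZeroDivisors_of_ne_zero hne) (hnone ▸ hbasis none) ?_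
      rw [hmul v F hv hF]
      exact (hsome v ▸ hbasis (some v)).mul (ih _)
  | algebraMap r =>
    exact isAlgebraic_algebraMap (algebraMap K (Algebra.adjoin K (Set.range x)) r)
  | add p q hp hq ihp ihq => exact ihp.add ihq
  | mul p q hp hq ihp ihq => exact ihp.mul ihq

theorem ringKrullDim_adjoin_of_insert_mul {K R V : Type*} [Field K] [CommRing R] [IsDomain R]
    [Algebra K R] [Finite V] {P : Set V → Prop} (hP : ∀ {F G : Set V}, F ⊆ G → P G → P F)
    (h0 : P ∅) (h1 : ∀ v, P {v}) (m : Set V → R)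
    (hmul : ∀ v F, v ∉ F → m ∅ * m (insert v F) = m {v} * m F)
    (hx : AlgebraicIndependent K fun o : Option V => m (o.elim ∅ fun v => {v}))
    {T : Subalgebra K R} (hT : T = Algebra.adjoin K (m '' {F | P F})) :
    ringKrullDim T = (Nat.card V + 1 : ℕ) := by
  have hmem : ∀ F, P F → m F ∈ T :=
    fun F hF => hT ▸ Algebra.subset_adjoin ⟨F, hF, rfl⟩
  have : Algebra.FiniteType K T :=
    (Subalgebra.fg_iff_finiteType _).1 (hT ▸ Subalgebra.fg_def.2 ⟨_, Set.toFinite _, rfl⟩)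
  let x : Option V → T
    | none => ⟨m ∅, hmem _ h0⟩
    | some v => ⟨m {v}, hmem _ (h1 v)⟩
  have hx' : AlgebraicIndependent K x := by
    refine AlgebraicIndependent.of_comp T.val ?_
    convert hx using 1
    funext o
    rcases o with _ | v <;> rfl
  have hb : IsTranscendenceBasis K x := by
    refine AlgebraicIndependent.isTranscendenceBasis_of_insert_mul hP
      (fun F hF => ⟨m F, hmem F hF⟩) h0 h1 (fun v F hv _ => Subtype.ext (hmul v F hv)) ?_ rfl
      (fun _ => rfl) hx'
    rw [eq_top_iff]
    rintro ⟨p, hp⟩ -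
    have hp' := hp
    rw [hT] at hp'
    induction hp' using Algebra.adjoin_induction with
    | mem p hp' =>
      obtain ⟨F, hF, rfl⟩ := hp'
      exact Algebra.subset_adjoin ⟨F, hF, rfl⟩
    | algebraMap r => exact Subalgebra.algebraMap_mem _ r
    | add p q hp1 hq1 ihp ihq =>
      rw [← hT] at hp1 hq1
      exact add_mem (ihp hp1) (ihq hq1)
    | mul p q hp1 hq1 ihp ihq =>
      rw [← hT] at hp1 hq1
      exact mul_mem (ihp hp1) (ihq hq1)
  rw [hb.ringKrullDim_eq_natCard, Finite.card_option]

/-! ### The fiber ring -/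

/-- Let `S = K + 𝔪`. If the subalgebra of `S[t]` generated over `K` by the elements `g t`, with `g`
in a generating set `G` of `I`, meets the extension of `𝔪` to the Rees algebra of `I` only in zero,
then it maps isomorphically onto the fiber ring. -/
theorem ringKrullDim_reesAlgebra_quotient_eq {K S : Type*} [Field K] [CommRing S] [Algebra K S]
    {I 𝔪 : Ideal S} {G : Set S} (hG : I = Ideal.span G)
    {T : Subalgebra K (Polynomial S)} (hT : T = Algebra.adjoin K (Polynomial.monomial 1 '' G))
    (h𝔪 : ∀ s, ∃ r : K, s - algebraMap K S r ∈ 𝔪)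
    (hinj : ∀ p : reesAlgebra I, p ∈ 𝔪.map (algebraMap S (reesAlgebra I)) →
      (p : Polynomial S) ∈ T → p = 0) :
    ringKrullDim (reesAlgebra I ⧸ 𝔪.map (algebraMap S (reesAlgebra I))) =
      ringKrullDim T := by
  have hmem : ∀ j ∈ I, Polynomial.monomial 1 j ∈ reesAlgebra I := fun j hj =>
    reesAlgebra.monomial_mem.2 (by rwa [pow_one])
  have hle : T ≤ (reesAlgebra I).restrictScalars K := by
    rw [hT]
    refine Algebra.adjoin_le ?_
    rintro _ ⟨g, hg, rfl⟩
    exact hmem g (hG ▸ Ideal.subset_span hg)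
  let f : T →+*
      reesAlgebra I ⧸ 𝔪.map (algebraMap S (reesAlgebra I)) :=
    (Ideal.Quotient.mk _).comp (Subalgebra.inclusion hle).toRingHom
  have hS : ∀ s : S, Ideal.Quotient.mk (𝔪.map (algebraMap S (reesAlgebra I)))
      (algebraMap S _ s) ∈ f.range := by
    intro s
    obtain ⟨r, hr⟩ := h𝔪 s
    refine ⟨algebraMap K _ r, ?_⟩
    refine Eq.symm ((Ideal.Quotient.eq (I := 𝔪.map (algebraMap S (reesAlgebra I)))).2 ?_)
    have := Ideal.mem_map_of_mem (algebraMap S (reesAlgebra I)) hr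
    rw [map_sub] at this
    exact this
  have hJ : ∀ j (hj : j ∈ I), Ideal.Quotient.mk (𝔪.map (algebraMap S (reesAlgebra I)))
      ⟨Polynomial.monomial 1 j, hmem j hj⟩ ∈ f.range := by
    intro j hj
    have hj' := hj
    rw [hG] at hj'
    induction hj' using Submodule.span_induction with
    | mem j hj' => exact ⟨⟨_, hT ▸ Algebra.subset_adjoin ⟨j, hj', rfl⟩⟩, rfl⟩
    | zero =>
      convert zero_mem f.range
      rw [Ideal.Quotient.eq_zero_iff_mem]
      exact (congrArg (· ∈ _) (Subtype.ext (Polynomial.monomial_zero_right 1))).mpr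
        (zero_mem _)
    | add p q hp hq ihp ihq =>
      rw [← Ideal.span, ← hG] at hp hq
      convert add_mem (ihp hp) (ihq hq) using 1
      rw [← map_add]
      exact congrArg _ (Subtype.ext (map_add _ p q))
    | smul s p hp ih =>
      rw [← Ideal.span, ← hG] at hp
      convert mul_mem (hS s) (ih hp) using 1
      rw [← map_mul]
      exact congrArg _ (Subtype.ext (Polynomial.C_mul_monomial.symm))
  symm
  refine ringKrullDim_eq_of_ringEquiv (RingEquiv.ofBijective f ⟨?_, fun x => ?_⟩)
  · rw [injective_iff_map_eq_zero]
    intro p hp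
    have hp0 := hinj _ (Ideal.Quotient.eq_zero_iff_mem.1 hp) p.2
    exact Subtype.ext (congrArg (fun q : reesAlgebra I => (q : Polynomial S)) hp0)
  · rw [← Set.mem_range, ← RingHom.coe_range, SetLike.mem_coe]
    obtain ⟨⟨p, hp⟩, rfl⟩ := Ideal.Quotient.mk_surjective x
    have hp' := hp
    rw [← adjoin_monomial_eq_reesAlgebra] at hp'
    induction hp' using Algebra.adjoin_induction with
    | mem p hp' =>
      obtain ⟨j, hj, rfl⟩ := hp'
      exact hJ j hj
    | algebraMap s => exact hS s
    | add p q hp1 hq1 ihp ihq =>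
      rw [adjoin_monomial_eq_reesAlgebra] at hp1 hq1
      exact add_mem (ihp hp1) (ihq hq1)
    | mul p q hp1 hq1 ihp ihq =>
      rw [adjoin_monomial_eq_reesAlgebra] at hp1 hq1
      exact mul_mem (ihp hp1) (ihq hq1)

namespace SimpleGraph

open MvPolynomial

/-- The monomial `m_F = ∏ v ∉ F, x_v * ∏ v ∈ F, y_v`. For independent sets `F` of `H` these are the
generators of the cover ideal of the whisker graph of `H`. -/
noncomputable def whiskerMonomial {V : Type*} [Finite V] (K : Type*) [Field K] (F : Set V) :
    MvPolynomial (V ⊕ V) K :=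
  monomial (whiskerExponent 1 (F.indicator 1)) 1

theorem isHomogeneous_coeff_of_mem_adjoin {V K : Type*} [Fintype V] [Field K]
    {𝓕 : Set (Set V)} {p : Polynomial (MvPolynomial (V ⊕ V) K)}
    (hp : p ∈ Algebra.adjoin K (Polynomial.monomial 1 '' (whiskerMonomial K '' 𝓕))) (k : ℕ) :
    (p.coeff k).IsHomogeneous (Fintype.card V * k) := by
  classical
  induction hp using Algebra.adjoin_induction generalizing k with
  | mem p hp =>
    obtain ⟨_, ⟨F, -, rfl⟩, rfl⟩ := hp
    rw [Polynomial.coeff_monomial]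
    split_ifs with hk
    · subst hk
      exact isHomogeneous_monomial _ (degree_whiskerExponent (indicator_one_le_one F))
    · exact isHomogeneous_zero _ _ _
  | algebraMap r =>
    rw [Polynomial.algebraMap_apply, Polynomial.coeff_C]
    split_ifs with hk
    · subst hk
      exact isHomogeneous_C _ _
    · exact isHomogeneous_zero _ _ _
  | add p q _ _ hp hq =>
    rw [Polynomial.coeff_add]
    exact (hp k).add (hq k)
  | mul p q _ _ hp hq =>
    rw [Polynomial.coeff_mul]
    refine IsHomogeneous.sum _ _ _ fun x hx => ?_
    rw [← Finset.HasAntidiagonal.mem_antidiagonal.1 hx, mul_add]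
    exact (hp _).mul (hq _)

theorem coeff_mem_of_mem_map_idealOfVars {V K : Type*} [Fintype V] [Field K]
    {H : SimpleGraph V} {p : reesAlgebra (H.whiskerGraph.coverIdeal K)}
    (hp : p ∈ (idealOfVars (V ⊕ V) K).map (algebraMap (MvPolynomial (V ⊕ V) K)
      (reesAlgebra (H.whiskerGraph.coverIdeal K)))) : ∀ k,
    (p : Polynomial (MvPolynomial (V ⊕ V) K)).coeff k ∈
      idealOfVars (V ⊕ V) K ^ (Fintype.card V * k + 1) := by
  refine Submodule.span_induction (p := fun (q : reesAlgebra (H.whiskerGraph.coverIdeal K)) _ =>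
    ∀ k, (q : Polynomial (MvPolynomial (V ⊕ V) K)).coeff k ∈
      idealOfVars (V ⊕ V) K ^ (Fintype.card V * k + 1)) ?_ ?_ ?_ ?_ hp
  · rintro _ ⟨s, hs, rfl⟩ k
    change (Polynomial.C s).coeff k ∈ _
    rw [Polynomial.coeff_C]
    split_ifs with hk
    · subst hk
      simpa using hs
    · exact zero_mem _
  · exact fun _ => zero_mem _
  · intro p q _ _ hp hq k
    exact add_mem (hp k) (hq k)
  · intro r q _ hq' k
    have hr := (mem_reesAlgebra_iff _ _).1 r.2
    change ((r : Polynomial (MvPolynomial (V ⊕ V) K)) * (q : Polynomial _)).coeff k ∈ _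
    rw [Polynomial.coeff_mul]
    refine sum_mem fun x hx => ?_
    rw [← Finset.HasAntidiagonal.mem_antidiagonal.1 hx, mul_add, add_assoc, pow_add]
    exact Ideal.mul_mem_mul (H.coverIdeal_whiskerGraph_pow_le _ (hr _)) (hq' _)

/-- The substitution `x_v ↦ 1`, `y_v ↦ u_v / u`, `t ↦ u` with values in the field `K(u, u_v)` maps
the generators `m_∅ t` and `m_{v} t` to the indeterminates `u` and `u_v`. -/
theorem algebraicIndependent_monomial_whiskerMonomial (V K : Type*) [Finite V] [Field K] :
    AlgebraicIndependent K fun o : Option V =>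
      Polynomial.monomial 1 (whiskerMonomial K (o.elim ∅ fun v : V => {v})) := by
  classical
  have := Fintype.ofFinite V
  let A := MvPolynomial (Option V) K
  let φ : MvPolynomial (V ⊕ V) K →ₐ[K] FractionRing A := aeval (Sum.elim (fun _ => 1)
    fun v => algebraMap A _ (X (some v)) / algebraMap A _ (X none))
  let ψ : Polynomial (MvPolynomial (V ⊕ V) K) →+* FractionRing A :=
    Polynomial.eval₂RingHom φ.toRingHom (algebraMap A _ (X none))
  have h0 : algebraMap A (FractionRing A) (X none) ≠ 0 := by
    simp [A]
  have hφ : ∀ a : V → ℕ, φ (monomial (whiskerExponent 1 a) 1) =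
      ∏ v, (algebraMap A (FractionRing A) (X (some v)) / algebraMap A _ (X none)) ^ a v := by
    intro a
    rw [aeval_monomial, Finsupp.prod_fintype _ _ (by simp), Fintype.prod_sum_type]
    simp
  have hψ : ∀ o : Option V, ψ (Polynomial.monomial 1
      (whiskerMonomial K (o.elim ∅ fun v : V => {v}))) = algebraMap A _ (X o) := by
    intro o
    simp only [ψ, Polynomial.coe_eval₂RingHom, Polynomial.eval₂_monomial]
    change φ _ * _ = _
    rw [whiskerMonomial, hφ]
    rcases o with _ | v
    · simp
    · rw [Finset.prod_eq_single v]
      · simp only [Option.elim_some, Set.indicator_of_mem, Set.mem_singleton, Pi.one_apply,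
          pow_one]
        exact div_mul_cancel₀ _ h0
      · intro w _ hw
        simp [hw]
      · simp
  have hcomp : ψ.comp (aeval fun o : Option V => Polynomial.monomial 1
      (whiskerMonomial K (o.elim ∅ fun v : V => {v}))).toRingHom =
        algebraMap A (FractionRing A) := by
    refine MvPolynomial.ringHom_ext (fun r => ?_) fun o => ?_
    · change ψ (aeval _ (C r)) = _
      rw [aeval_C]
      change ψ (Polynomial.C (C r)) = _
      simp only [ψ, Polynomial.coe_eval₂RingHom, Polynomial.eval₂_C]
      exact φ.commutes r
    · simpa using hψ o
  have hinj := IsFractionRing.injective A (FractionRing A)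
  rw [← hcomp] at hinj
  exact Function.Injective.of_comp (f := ψ) hinj

theorem whiskerMonomial_mul_insert {V K : Type*} [Finite V] [Field K] {F : Set V} {v : V}
    (hv : v ∉ F) : whiskerMonomial K ∅ * whiskerMonomial K (insert v F) =
      whiskerMonomial K {v} * whiskerMonomial K F := by
  rw [whiskerMonomial, whiskerMonomial, whiskerMonomial, whiskerMonomial, monomial_mul,
    monomial_mul, whiskerExponent_add (indicator_one_le_one _) (indicator_one_le_one _),
    whiskerExponent_add (indicator_one_le_one _) (indicator_one_le_one _), Set.indicator_empty',
    zero_add, Set.insert_eq, Set.indicator_union_of_disjoint (Set.disjoint_singleton_left.2 hv)]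
  rfl

/-- The coefficient of `t ^ k` is homogeneous of degree `n k` for an element of the subalgebra
generated by the `m_F t`, and has order greater than `n k` for an element of the extension of the
maximal graded ideal to the Rees algebra; hence the two meet only in zero. -/
theorem analyticSpread_coverIdeal_whiskerGraph {V K : Type*} [Fintype V] [Field K]
    (H : SimpleGraph V) : analyticSpread (H.whiskerGraph.coverIdeal K) =
      ((Fintype.card V + 1 : ℕ) : WithBot ℕ∞) := by
  have hG : H.whiskerGraph.coverIdeal K =
      Ideal.span (whiskerMonomial K '' {F | H.IsIndepSet F}) := by
    rw [coverIdeal_whiskerGraph_eq_span]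
    refine congrArg Ideal.span (Set.ext fun u => ⟨?_, ?_⟩)
    · rintro ⟨_, ⟨F, hF, rfl⟩, rfl⟩
      exact ⟨F, hF, rfl⟩
    · rintro ⟨F, hF, rfl⟩
      exact ⟨_, ⟨F, hF, rfl⟩, rfl⟩
  -- An opaque `T` keeps the elaborator from unfolding the subalgebra in its ring instances.
  obtain ⟨T, hT⟩ : ∃ T, T = Algebra.adjoin K
      (Polynomial.monomial 1 '' (whiskerMonomial K '' {F | H.IsIndepSet F})) := ⟨_, rfl⟩
  have hdim : ringKrullDim T = (Nat.card V + 1 : ℕ) := by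
    refine ringKrullDim_adjoin_of_insert_mul (P := fun F => H.IsIndepSet F)
      (fun h hG => hG.mono h) (Set.pairwise_empty _) (fun v => Set.pairwise_singleton v _)
      (fun F => Polynomial.monomial 1 (whiskerMonomial K F)) (fun v F hv => ?_)
      (algebraicIndependent_monomial_whiskerMonomial V K)
      (hT.trans (congrArg _ (Set.image_image _ _ _)))
    rw [Polynomial.monomial_mul_monomial, Polynomial.monomial_mul_monomial,
      whiskerMonomial_mul_insert hv]
  rw [← Nat.card_eq_fintype_card, ← hdim]
  refine ringKrullDim_reesAlgebra_quotient_eq hG hT ?_ ?_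
  · intro s
    refine ⟨constantCoeff s, ?_⟩
    rw [← pow_one (idealOfVars _ _), mem_pow_idealOfVars_iff']
    intro m hm
    rw [Nat.lt_one_iff, Finsupp.degree_eq_zero_iff] at hm
    subst hm
    simp [algebraMap_eq, constantCoeff_eq]
  · intro p hp hpT
    have hp' := coeff_mem_of_mem_map_idealOfVars hp
    refine Subtype.ext (Polynomial.ext fun k => ?_)
    ext m
    by_contra hm
    have h1 := isHomogeneous_coeff_of_mem_adjoin (hT ▸ hpT) k
    have h2 := (mem_pow_idealOfVars_iff _ _).1 (hp' k) m (mem_support_iff.2 hm)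
    have h3 : m.degree = Fintype.card V * k := by
      rw [Finsupp.degree_eq_weight_one]
      exact h1 hm
    omega

end SimpleGraph

/-! ### Limit depth, depth stability and analytic spread -/

theorem theorem4p9 {K : Type*} [Field K] (n : ℕ) (hn : 1 ≤ n) (H : SimpleGraph (Fin n)) :
    MvPolynomial.HasLimitDepth (H.whiskerGraph.coverIdeal K) ((n - 1 : ℕ) : ℕ∞) ∧
    MvPolynomial.dstab (H.whiskerGraph.coverIdeal K) ≤ (n : ℕ∞) ∧
    MvPolynomial.analyticSpread (H.whiskerGraph.coverIdeal K) = ((n + 1 : ℕ) : WithBot ℕ∞) := by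
  have : Nonempty (Fin n) := ⟨⟨0, hn⟩⟩
  have hdepth : ∀ k, n ≤ k →
      MvPolynomial.depthQuotPow (H.whiskerGraph.coverIdeal K) k = ((n - 1 : ℕ) : ℕ∞) := by
    intro k hk
    simpa using H.depthQuotPow_coverIdeal_whiskerGraph (K := K) (k := k) (by simpa using hk)
  refine ⟨Filter.eventually_atTop.2 ⟨n, hdepth⟩, ?_, ?_⟩
  · exact iInf₂_le n ⟨hn, fun k hk => (hdepth k hk).trans (hdepth n le_rfl).symm⟩
  · simpa using H.analyticSpread_coverIdeal_whiskerGraph (K := K)
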